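/- Let $r,\lambda_1,\alpha,c>0$ be real numbers. Let the waiting times $T_1,T_2,\dots$ and the claim sizes $X_1,X_2,\dots$ be independent random variables (all of them jointly independent), where each $T_i$ has the gamma distribution $\Gamma(r,\lambda_1)$ with shape $r$ and rate $\lambda_1$, i.e. density $\frac{\lambda_1^r}{\Gamma(r)}t^{r-1}e^{-\lambda_1 t}$ for $t>0$, and each $X_i$ has the exponential distribution with rate $\alpha$. Assume the net profit condition $c\,\mathbb{E}[T_i]>\mathbb{E}[X_i]$. Let $N_r(t)=\#\{n\ge 1: T_1+\dots+T_n\le t\}$, let $R_r(t)=u+ct-\sum_{i=1}^{N_r(t)}X_i$ be the surplus at time $t>0$ with initial capital $u$ and premium rate $c$, and let $\psi_r(u)=\mathbb{P}\left[\inf\{R_r(t):t>0\}<0\right]$ be the ruin probability. Then the equation $$c^r x^r\left[x-\left(\frac{\lambda_1}{c}+\alpha\right)\right]+\alpha\lambda_1^r=0$$ has exactly two roots in $[0,\infty)$, namely $\lambda_1/c$ and a larger root $x_2>\lambda_1/c$, and $$\psi_r(u)=\left(\frac{\lambda_1}{c\,x_2}\right)^r e^{-\left(x_2-\frac{\lambda_1}{c}\right)u}\qquad\text{for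 all } u>0 .$$ -/

import Mathlib

open MeasureTheory ProbabilityTheory

noncomputable section

namespace RenewalRisk

variable {Ω : Type*}

/-- Arrival time of claim number `n + 1` : the sum of the first `n + 1` waiting times
`T 0, …, T n` (claims and waiting times are numbered from `0`). -/
def arrivalTime (T : ℕ → Ω → ℝ) (n : ℕ) (ω : Ω) : ℝ :=
  ∑ i ∈ Finset.range (n + 1), T i ω

/-- The renewal counting process: the number of claims that have happened up to time `t`.
(The set is finite for almost every `ω` when the waiting times are i.i.d. and positive.) -/
def claimNumber (T : ℕ → Ω → ℝ) (t : ℝ) (ω : Ω) : ℕ :=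
  {n : ℕ | arrivalTime T n ω ≤ t}.ncard

/-- The surplus `R(t) = u + c t - ∑_{i ≤ N(t)} X_i`, with initial capital `u` and
premium rate `c`. -/
def surplus (T X : ℕ → Ω → ℝ) (c u t : ℝ) (ω : Ω) : ℝ :=
  u + c * t - ∑ i ∈ Finset.range (claimNumber T t ω), X i ω

/-- The ruin probability `ψ(u) = P[inf {R(t) : t > 0} < 0]` for the initial capital `u`;
the infimum is taken in the extended reals. -/
def ruinProbability [MeasurableSpace Ω] (P : Measure Ω) (T X : ℕ → Ω → ℝ) (c u : ℝ) : ℝ :=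
  P.real {ω | (⨅ t : {t : ℝ // 0 < t}, (surplus T X c u t ω : EReal)) < 0}

/-- `T` and `X` are the waiting times and the claim sizes of a gamma-time risk model with
exponential claims: all these variables are independent, the waiting times have the gamma law
with shape `r` and rate `lam`, the claim sizes the exponential law with rate `α`. -/
structure IsGammaTimeModel [MeasurableSpace Ω] (P : Measure Ω) (T X : ℕ → Ω → ℝ)
    (r lam α : ℝ) : Prop where
  waiting_law : ∀ i, HasLaw (T i) (gammaMeasure r lam) P
  claim_law : ∀ i, HasLaw (X i) (expMeasure α) P
  indep : iIndepFun (Sum.elim T X) P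

/-- The net profit condition `c E[T_i] > E[X_i]`. -/
def NetProfit [MeasurableSpace Ω] (P : Measure Ω) (T X : ℕ → Ω → ℝ) (c : ℝ) : Prop :=
  ∀ i, ∫ ω, X i ω ∂P < c * ∫ ω, T i ω ∂P

end RenewalRisk

end

open Filter Topology Set

namespace RenewalRisk

/-! ### Integrals against gamma and exponential laws -/

/-! Put γ = x₂ - lam/c and C = (lam/(c x₂))^r; the characteristic equation at x₂ says exactly that C
= (α - γ)/α. The surplus drops only at claims, so ruin means that the walk u + ∑ (c T_i - X_i)
becomes negative (`iInf_surplus_neg_iff`). The function g that is 1 on negatives and C e^{-γv} for v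
≥ 0 is harmonic for this walk at every v ≥ 0 (`integral_ruinProfile_step`): averaging over a claim
turns g into e^{-γv}, and averaging over a waiting time restores the factor C, the Laplace transform
of c T at γ. Hence g of the walk stopped on becoming negative has constant mean g(u). By net profit
and the strong law the free walk tends to infinity, so g of the stopped walk tends to the indicator
of ruin, and bounded convergence gives ψ(u) = g(u). -/

theorem integral_gammaMeasure {a b : ℝ} (ha : 0 < a) (hb : 0 < b) (f : ℝ → ℝ) :
    ∫ x, f x ∂gammaMeasure a b =
      ∫ x in Ioi 0, (b ^ a / Real.Gamma a * x ^ (a - 1) * Real.exp (-(b * x))) * f x := by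
  have hm : Measurable (gammaPDF a b) := (measurable_gammaPDFReal a b).ennreal_ofReal
  rw [gammaMeasure, integral_withDensity_eq_integral_toReal_smul hm
    (ae_of_all _ fun x => ENNReal.ofReal_lt_top), ← integral_Ici_eq_integral_Ioi,
    ← integral_indicator measurableSet_Ici]
  refine integral_congr_ae (ae_of_all _ fun x => ?_)
  simp only [gammaPDF, ENNReal.toReal_ofReal (gammaPDFReal_nonneg ha hb x), smul_eq_mul]
  by_cases hx : 0 ≤ x
  · rw [indicator_of_mem (mem_Ici.2 hx), gammaPDFReal, if_pos hx]
  · rw [indicator_of_notMem (by simpa using hx), gammaPDFReal, if_neg hx, zero_mul]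

theorem integral_id_gammaMeasure {a b : ℝ} (ha : 0 < a) (hb : 0 < b) :
    ∫ x, x ∂gammaMeasure a b = a / b := by
  have h : ∀ x ∈ Ioi (0 : ℝ), (b ^ a / Real.Gamma a * x ^ (a - 1) * Real.exp (-(b * x))) * x =
      b ^ a / Real.Gamma a * (x ^ (a + 1 - 1) * Real.exp (-(b * x))) := by
    intro x hx
    rw [show a + 1 - 1 = a - 1 + 1 by ring, Real.rpow_add_one (ne_of_gt hx)]
    ring
  have hG := (Real.Gamma_pos_of_pos ha).ne'
  have hp := (Real.rpow_pos_of_pos hb a).ne'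
  rw [integral_gammaMeasure ha hb, setIntegral_congr_fun measurableSet_Ioi h,
    integral_const_mul, Real.integral_rpow_mul_exp_neg_mul_Ioi (by linarith) hb,
    Real.Gamma_add_one ha.ne', Real.rpow_add_one (by positivity),
    Real.div_rpow zero_le_one hb.le, Real.one_rpow]
  field_simp

theorem integral_exp_neg_mul_gammaMeasure {a b s : ℝ} (ha : 0 < a) (hb : 0 < b) (hs : 0 ≤ s) :
    ∫ x, Real.exp (-(s * x)) ∂gammaMeasure a b = (b / (b + s)) ^ a := by
  have h : ∀ x ∈ Ioi (0 : ℝ), (b ^ a / Real.Gamma a * x ^ (a - 1) * Real.exp (-(b * x))) *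
      Real.exp (-(s * x)) =
      b ^ a / Real.Gamma a * (x ^ (a - 1) * Real.exp (-((b + s) * x))) := by
    intro x _
    rw [show -((b + s) * x) = -(b * x) + -(s * x) by ring, Real.exp_add]
    ring
  have hG := (Real.Gamma_pos_of_pos ha).ne'
  rw [integral_gammaMeasure ha hb, setIntegral_congr_fun measurableSet_Ioi h,
    integral_const_mul, Real.integral_rpow_mul_exp_neg_mul_Ioi ha (by linarith),
    Real.div_rpow zero_le_one (by linarith), Real.one_rpow, Real.div_rpow hb.le (by linarith)]
  field_simp

theorem ae_gammaMeasure_pos (a b : ℝ) : ∀ᵐ x ∂gammaMeasure a b, 0 < x := by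
  have hm : Measurable (gammaPDF a b) := (measurable_gammaPDFReal a b).ennreal_ofReal
  rw [gammaMeasure, ae_withDensity_iff hm]
  have h0 : ∀ᵐ x : ℝ, x ≠ 0 := by simp [ae_iff]
  filter_upwards [h0] with x hx hx'
  by_contra hlt
  exact hx' (gammaPDF_of_neg (lt_of_le_of_ne (not_lt.1 hlt) hx))

/-! ### The harmonic function -/

/-- The function that is `1` on the negative half line and `C e^{-γ v}` for `v ≥ 0`. -/
noncomputable def ruinProfile (C γ v : ℝ) : ℝ := if v < 0 then 1 else C * Real.exp (-(γ * v))

theorem measurable_ruinProfile (C γ : ℝ) : Measurable (ruinProfile C γ) := by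
  unfold ruinProfile
  exact Measurable.ite measurableSet_Iio measurable_const (by fun_prop)

theorem ruinProfile_of_nonneg {v : ℝ} (C γ : ℝ) (hv : 0 ≤ v) :
    ruinProfile C γ v = C * Real.exp (-(γ * v)) := if_neg (not_lt.2 hv)

theorem ruinProfile_of_neg {v : ℝ} (C γ : ℝ) (hv : v < 0) : ruinProfile C γ v = 1 := if_pos hv

theorem norm_ruinProfile_le {C γ : ℝ} (hC : 0 ≤ C) (hC' : C ≤ 1) (hγ : 0 ≤ γ) (v : ℝ) :
    ‖ruinProfile C γ v‖ ≤ 1 := by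
  rcases lt_or_ge v 0 with hv | hv
  · simp [ruinProfile_of_neg C γ hv]
  · rw [ruinProfile_of_nonneg C γ hv, Real.norm_of_nonneg (by positivity)]
    exact mul_le_one₀ hC' (Real.exp_nonneg _) (Real.exp_le_one_iff.2 (by nlinarith))

theorem integrable_ruinProfile_comp {E : Type*} [MeasurableSpace E] {μ : Measure E}
    [IsFiniteMeasure μ] {C γ : ℝ} (hC : 0 ≤ C) (hC' : C ≤ 1) (hγ : 0 ≤ γ) {f : E → ℝ}
    (hf : Measurable f) : Integrable (fun e => ruinProfile C γ (f e)) μ :=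
  .of_bound ((measurable_ruinProfile C γ).comp hf).aestronglyMeasurable 1
    (ae_of_all _ fun _ => norm_ruinProfile_le hC hC' hγ _)

/-- Claims x ≤ v contribute e^{-γv} - e^{-αv}, because Cα/(α - γ) = 1; claims x > v contribute the
tail e^{-αv}, which cancels. -/
theorem integral_ruinProfile_sub_expMeasure {α C γ v : ℝ} (hγ : 0 < γ) (hγα : γ < α)
    (hC : C = (α - γ) / α) (hv : 0 ≤ v) :
    ∫ x, ruinProfile C γ (v - x) ∂expMeasure α = Real.exp (-(γ * v)) := by
  have hα : 0 < α := hγ.trans hγα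
  have hC0 : 0 ≤ C := hC ▸ div_nonneg (by linarith) hα.le
  have hC1 : C ≤ 1 := by rw [hC, div_le_one hα]; linarith
  rw [expMeasure, integral_gammaMeasure one_pos hα]
  have hint : IntegrableOn (fun x : ℝ => (α ^ (1 : ℝ) / Real.Gamma 1 * x ^ ((1 : ℝ) - 1) *
      Real.exp (-(α * x))) * ruinProfile C γ (v - x)) (Ioi 0) := by
    have h1 : IntegrableOn (fun x : ℝ => α * Real.exp (-α * x)) (Ioi 0) :=
      (integrableOn_exp_mul_Ioi (neg_lt_zero.2 hα) 0).const_mul α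
    refine (h1.mul_bdd (c := 1) (g := fun x => ruinProfile C γ (v - x))
      ((measurable_ruinProfile C γ).comp (by fun_prop)).aestronglyMeasurable
      (ae_of_all _ fun x => norm_ruinProfile_le hC0 hC1 hγ.le _)).congr (ae_of_all _ fun x => ?_)
    simp
  rw [← Ioc_union_Ioi_eq_Ioi hv, setIntegral_union (Ioc_disjoint_Ioi le_rfl) measurableSet_Ioi
    (hint.mono_set Ioc_subset_Ioi_self) (hint.mono_set (Ioi_subset_Ioi hv))]
  have e1 : ∀ x ∈ Ioc 0 v, (α ^ (1 : ℝ) / Real.Gamma 1 * x ^ ((1 : ℝ) - 1) *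
      Real.exp (-(α * x))) * ruinProfile C γ (v - x) =
      Real.exp (-(γ * v)) * ((α - γ) * Real.exp (-((α - γ) * x))) := by
    intro x hx
    rw [ruinProfile_of_nonneg C γ (by linarith [hx.2]), hC,
      show -(γ * (v - x)) = -(γ * v) + γ * x by ring, Real.exp_add,
      show -((α - γ) * x) = -(α * x) + γ * x by ring, Real.exp_add]
    simp only [Real.rpow_one, Real.Gamma_one, sub_self, Real.rpow_zero]
    field_simp
  have e2 : ∀ x ∈ Ioi v, (α ^ (1 : ℝ) / Real.Gamma 1 * x ^ ((1 : ℝ) - 1) *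
      Real.exp (-(α * x))) * ruinProfile C γ (v - x) = α * Real.exp (-α * x) := by
    intro x hx
    rw [ruinProfile_of_neg C γ (sub_neg.2 hx)]
    simp
  rw [setIntegral_congr_fun measurableSet_Ioc e1, setIntegral_congr_fun measurableSet_Ioi e2,
    integral_const_mul (Real.exp (-(γ * v))), integral_const_mul α,
    integral_exp_mul_Ioi (neg_lt_zero.2 hα),
    ← intervalIntegral.integral_of_le hv,
    intervalIntegral.integral_eq_sub_of_hasDerivAt
      (f := fun x => -Real.exp (-((α - γ) * x))) (a := 0) (b := v)]
  · have h3 : Real.exp (-α * v) = Real.exp (-(γ * v)) * Real.exp (-((α - γ) * v)) := by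
      rw [← Real.exp_add]; ring_nf
    rw [h3]
    simp only [mul_zero, neg_zero, Real.exp_zero]
    field_simp
    ring
  · intro x _
    have h := (((hasDerivAt_id x).const_mul (α - γ)).neg.exp).neg
    refine h.congr_deriv ?_
    simp only [Pi.neg_apply, id, mul_one]
    ring
  · exact Continuous.intervalIntegrable (by fun_prop) _ _

theorem integral_ruinProfile_step {r lam α c C γ v : ℝ} (hr : 0 < r) (hlam : 0 < lam)
    (hc : 0 < c) (hγ : 0 < γ) (hγα : γ < α) (hC : C = (α - γ) / α)
    (hC' : C = (lam / (lam + c * γ)) ^ r) (hv : 0 ≤ v) :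
    ∫ p : ℝ × ℝ, ruinProfile C γ (v + (c * p.1 - p.2)) ∂(gammaMeasure r lam).prod (expMeasure α) =
      ruinProfile C γ v := by
  have hα : 0 < α := hγ.trans hγα
  have hC0 : 0 ≤ C := hC ▸ div_nonneg (by linarith) hα.le
  have hC1 : C ≤ 1 := by rw [hC, div_le_one hα]; linarith
  have := isProbabilityMeasure_gammaMeasure hr hlam
  have := isProbabilityMeasure_expMeasure hα
  rw [integral_prod _ (integrable_ruinProfile_comp hC0 hC1 hγ.le (by fun_prop))]
  have h : ∀ᵐ t ∂gammaMeasure r lam, ∫ x, ruinProfile C γ (v + (c * t - x)) ∂expMeasure α =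
      Real.exp (-(γ * v)) * Real.exp (-(c * γ * t)) := by
    filter_upwards [ae_gammaMeasure_pos r lam] with t ht
    have : ∀ x, v + (c * t - x) = v + c * t - x := fun x => by ring
    simp only [this]
    rw [integral_ruinProfile_sub_expMeasure hγ hγα hC (by positivity), ← Real.exp_add]
    ring_nf
  rw [integral_congr_ae h, integral_const_mul,
    integral_exp_neg_mul_gammaMeasure hr hlam (by positivity), ruinProfile_of_nonneg C γ hv, ← hC',
    mul_comm]

/-! ### The walk stopped at its first negative value -/

/-- The walk with increments `y 0, y 1, …` started at `u` and stopped once it is negative. -/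
noncomputable def stoppedWalk (y : ℕ → ℝ) (u : ℝ) : ℕ → ℝ
  | 0 => u
  | n + 1 => if stoppedWalk y u n < 0 then stoppedWalk y u n else stoppedWalk y u n + y n

theorem stoppedWalk_neg_of_le {y : ℕ → ℝ} {u : ℝ} {m n : ℕ} (hmn : m ≤ n)
    (h : stoppedWalk y u m < 0) : stoppedWalk y u n < 0 := by
  induction n, hmn using Nat.le_induction with
  | base => exact h
  | succ n _ ih => rwa [stoppedWalk, if_pos ih]

theorem stoppedWalk_eq_of_stoppedWalk_nonneg {y : ℕ → ℝ} {u : ℝ}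
    (h : ∀ n, 0 ≤ stoppedWalk y u n) (n : ℕ) :
    stoppedWalk y u n = u + ∑ i ∈ Finset.range n, y i := by
  induction n with
  | zero => simp [stoppedWalk]
  | succ n ih =>
    rw [stoppedWalk, if_neg (not_lt.2 (h n)), ih, Finset.sum_range_succ, add_assoc]

theorem stoppedWalk_eq_of_walk_nonneg {y : ℕ → ℝ} {u : ℝ}
    (h : ∀ n, 0 ≤ u + ∑ i ∈ Finset.range n, y i) (n : ℕ) :
    stoppedWalk y u n = u + ∑ i ∈ Finset.range n, y i := by
  induction n with
  | zero => simp [stoppedWalk]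
  | succ n ih =>
    rw [stoppedWalk, ih, if_neg (not_lt.2 (h n)), Finset.sum_range_succ, add_assoc]

theorem eventually_stoppedWalk_neg {y : ℕ → ℝ} {u : ℝ}
    (h : ∃ n, u + ∑ i ∈ Finset.range n, y i < 0) : ∀ᶠ n in atTop, stoppedWalk y u n < 0 := by
  obtain ⟨m, hm⟩ : ∃ m, stoppedWalk y u m < 0 := by
    by_contra! hcon
    obtain ⟨n, hn⟩ := h
    linarith [hcon n, stoppedWalk_eq_of_stoppedWalk_nonneg hcon n]
  exact (eventually_ge_atTop m).mono fun n hn => stoppedWalk_neg_of_le hn hm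

/-- The σ-algebra is arbitrary and only the increments before `n` enter; this later yields
independence from the pair numbered `n`. -/
theorem measurable_stoppedWalk {Ω : Type*} {m : MeasurableSpace Ω} {Y : ℕ → Ω → ℝ} (u : ℝ) (n : ℕ)
    (hY : ∀ i < n, Measurable (Y i)) :
    Measurable fun ω => stoppedWalk (fun i => Y i ω) u n := by
  induction n with
  | zero => exact measurable_const
  | succ n ih =>
    have hn := ih fun i hi => hY i (by omega)
    exact Measurable.ite (hn measurableSet_Iio) hn (hn.add (hY n (by omega)))

theorem tendsto_ruinProfile_stoppedWalk {y : ℕ → ℝ} {u C γ : ℝ} (hγ : 0 < γ)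
    (hy : Tendsto (fun n => ∑ i ∈ Finset.range n, y i) atTop atTop) :
    Tendsto (fun n => ruinProfile C γ (stoppedWalk y u n)) atTop
      (𝓝 (open Classical in if ∃ n, u + ∑ i ∈ Finset.range n, y i < 0 then 1 else 0)) := by
  split_ifs with h
  · refine tendsto_const_nhds.congr' ?_
    filter_upwards [eventually_stoppedWalk_neg h] with n hn
    rw [ruinProfile_of_neg C γ hn]
  · push Not at h
    have h1 : Tendsto (fun n => C * Real.exp (-(γ * (u + ∑ i ∈ Finset.range n, y i)))) atTop
        (𝓝 (C * 0)) := by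
      refine Tendsto.const_mul C (Real.tendsto_exp_neg_atTop_nhds_zero.comp ?_)
      exact (tendsto_atTop_add_const_left _ u hy).const_mul_atTop hγ
    rw [mul_zero] at h1
    refine h1.congr fun n => ?_
    rw [stoppedWalk_eq_of_walk_nonneg h, ruinProfile_of_nonneg C γ (h n)]

end RenewalRisk

namespace RenewalRisk

/-! ### Ruin happens at a claim -/

variable {Ω : Type*}

theorem _root_.IsLowerSet.eq_Iio_ncard {A : Set ℕ} (hA : IsLowerSet A) (hfin : A.Finite) :
    A = Iio A.ncard := by
  obtain ⟨n, hn⟩ := hfin.exists_notMem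
  classical
  have hex : ∃ n, n ∉ A := ⟨n, hn⟩
  have h : A = Iio (Nat.find hex) := by
    ext k
    refine ⟨fun hk => ?_, fun hk => not_not.1 (Nat.find_min hex hk)⟩
    by_contra hlt
    exact Nat.find_spec hex (hA (not_lt.1 hlt) hk)
  have h2 : A.ncard = Nat.find hex := by
    conv_lhs => rw [h]
    simp [Set.ncard_eq_toFinset_card']
  rwa [h2]

theorem strictMono_arrivalTime {T : ℕ → Ω → ℝ} {ω : Ω} (hT : ∀ i, 0 < T i ω) :
    StrictMono fun n => arrivalTime T n ω :=
  strictMono_nat_of_lt_succ fun n => by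
    simp only [arrivalTime]
    rw [Finset.sum_range_succ _ (n + 1)]
    linarith [hT (n + 1)]

theorem arrivalTime_pos {T : ℕ → Ω → ℝ} {ω : Ω} (hT : ∀ i, 0 < T i ω) (n : ℕ) :
    0 < arrivalTime T n ω :=
  Finset.sum_pos (fun i _ => hT i) (by simp)

theorem claimNumber_arrivalTime {T : ℕ → Ω → ℝ} {ω : Ω} (hT : ∀ i, 0 < T i ω) (n : ℕ) :
    claimNumber T (arrivalTime T n ω) ω = n + 1 := by
  have h : {k : ℕ | arrivalTime T k ω ≤ arrivalTime T n ω} = Iic n := by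
    ext k
    exact (strictMono_arrivalTime hT).le_iff_le
  rw [claimNumber, h]
  simp [Set.ncard_eq_toFinset_card']

/-- Divergence of the arrival times makes the set finite; `ncard` of an infinite set would be 0. -/
theorem setOf_arrivalTime_le_eq_Iio {T : ℕ → Ω → ℝ} {ω : Ω} (hT : ∀ i, 0 < T i ω)
    (hlim : Tendsto (fun n => ∑ i ∈ Finset.range n, T i ω) atTop atTop) (t : ℝ) :
    {n : ℕ | arrivalTime T n ω ≤ t} = Iio (claimNumber T t ω) := by
  refine IsLowerSet.eq_Iio_ncard
    (fun a b hab ha => ((strictMono_arrivalTime hT).monotone hab).trans ha) ?_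
  have h := (hlim.comp (tendsto_add_atTop_nat 1)).eventually_gt_atTop t
  rw [← Nat.cofinite_eq_atTop] at h
  exact h.subset fun n (hn : arrivalTime T n ω ≤ t) => not_lt.2 hn

theorem iInf_surplus_neg_iff {T X : ℕ → Ω → ℝ} {ω : Ω} {c u : ℝ} (hc : 0 < c) (hu : 0 < u)
    (hT : ∀ i, 0 < T i ω)
    (hlim : Tendsto (fun n => ∑ i ∈ Finset.range n, T i ω) atTop atTop) :
    (⨅ t : {t : ℝ // 0 < t}, (surplus T X c u t ω : EReal)) < 0 ↔
      ∃ n, u + ∑ i ∈ Finset.range n, (c * T i ω - X i ω) < 0 := by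
  simp only [iInf_lt_iff, EReal.coe_neg', Finset.sum_sub_distrib, ← Finset.mul_sum, Subtype.exists,
    exists_prop]
  constructor
  · rintro ⟨t, ht, hR⟩
    refine ⟨claimNumber T t ω, ?_⟩
    rw [surplus] at hR
    -- Before the first claim the surplus is u + ct > 0. Otherwise t is at least the last arrival
    -- time, where the surplus is no larger.
    rcases hN : claimNumber T t ω with _ | n
    · rw [hN] at hR
      simp only [Finset.range_zero, Finset.sum_empty, sub_zero] at hR
      nlinarith
    · have hn : n ∈ {n : ℕ | arrivalTime T n ω ≤ t} := by
        rw [setOf_arrivalTime_le_eq_Iio hT hlim, hN]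
        exact n.lt_succ_self
      have hle : ∑ i ∈ Finset.range (n + 1), T i ω ≤ t := hn
      rw [hN] at hR
      nlinarith [mul_le_mul_of_nonneg_left hle hc.le]
  · rintro ⟨n, hn⟩
    rcases n with _ | n
    · simp at hn
      linarith
    · refine ⟨arrivalTime T n ω, arrivalTime_pos hT n, ?_⟩
      rw [surplus, claimNumber_arrivalTime hT, arrivalTime]
      linarith

/-! ### The characteristic equation -/

theorem exists_larger_root {r lam α c : ℝ} (hr : 0 < r) (hlam : 0 < lam) (hα : 0 < α)
    (hc : 0 < c) (hnet : lam / c < r * α) :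
    ∃ x₂ : ℝ, lam / c < x₂ ∧ x₂ < lam / c + α ∧
      {x : ℝ | 0 ≤ x ∧ c ^ r * x ^ r * (x - (lam / c + α)) + α * lam ^ r = 0} = {lam / c, x₂} := by
  set a := lam / c + α with ha
  set f : ℝ → ℝ := fun x => c ^ r * x ^ r * (x - a) + α * lam ^ r with hf
  -- The only critical point of `f` on (0, ∞): `f` falls before it and rises after it. The net
  -- profit inequality amounts to lam/c < m.
  set m := r * a / (r + 1) with hm
  have hlc : 0 < lam / c := by positivity
  have ha0 : 0 < a := by positivity
  have hcr : 0 < c ^ r := Real.rpow_pos_of_pos hc r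
  have hm0 : 0 < m := by positivity
  have hma : m < a := by
    rw [hm, div_lt_iff₀ (by linarith)]; linarith
  have hlm : lam / c < m := by
    rw [hm, lt_div_iff₀ (by linarith), ha]; linarith
  have hcont : Continuous f := by
    have := Real.continuous_rpow_const hr.le
    fun_prop
  have hderiv : ∀ x, 0 < x → deriv f x = c ^ r * x ^ (r - 1) * ((r + 1) * x - r * a) := by
    intro x hx
    have h1 := (((Real.hasDerivAt_rpow_const (p := r) (Or.inl hx.ne')).const_mul (c ^ r)).mul
      ((hasDerivAt_id x).sub_const a)).add_const (α * lam ^ r)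
    have h2 : x ^ r = x ^ (r - 1) * x := by
      rw [← Real.rpow_add_one hx.ne', sub_add_cancel]
    refine HasDerivAt.deriv (h1.congr_deriv ?_)
    simp only [id]
    rw [h2]
    ring
  have hanti : StrictAntiOn f (Icc 0 m) := by
    refine strictAntiOn_of_deriv_neg (convex_Icc 0 m) hcont.continuousOn fun x hx => ?_
    rw [interior_Icc] at hx
    rw [hderiv x hx.1]
    have h3 : (r + 1) * x < r * a := by
      have := (lt_div_iff₀ (by linarith : 0 < r + 1)).1 (hm ▸ hx.2)
      linarith
    have := Real.rpow_pos_of_pos hx.1 (r - 1)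
    exact mul_neg_of_pos_of_neg (by positivity) (by linarith)
  have hmono : StrictMonoOn f (Ici m) := by
    refine strictMonoOn_of_deriv_pos (convex_Ici m) hcont.continuousOn fun x hx => ?_
    rw [interior_Ici] at hx
    have hx0 : 0 < x := hm0.trans hx
    rw [hderiv x hx0]
    have h3 : r * a < (r + 1) * x := by
      have hx' : m < x := hx
      have := (div_lt_iff₀ (by linarith : 0 < r + 1)).1 (hm ▸ hx')
      linarith
    have := Real.rpow_pos_of_pos hx0 (r - 1)
    exact mul_pos (by positivity) (by linarith)
  have hroot : f (lam / c) = 0 := by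
    have h4 : c ^ r * (lam / c) ^ r = lam ^ r := by
      rw [← Real.mul_rpow hc.le hlc.le, mul_div_cancel₀ _ hc.ne']
    simp only [hf]
    rw [h4, ha]
    ring
  have hfm : f m < 0 := hroot ▸ hanti ⟨hlc.le, hlm.le⟩ ⟨hm0.le, le_rfl⟩ hlm
  -- The second root thus lies below `a`, which is what gives γ < α.
  have hfa : 0 < f a := by
    have := Real.rpow_pos_of_pos hlam r
    simp only [hf, sub_self, mul_zero, zero_add]
    positivity
  obtain ⟨x₂, hx₂, hfx₂⟩ := intermediate_value_Ioo hma.le hcont.continuousOn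
    (show (0 : ℝ) ∈ Ioo (f m) (f a) from ⟨hfm, hfa⟩)
  refine ⟨x₂, hlm.trans hx₂.1, hx₂.2, ?_⟩
  ext x
  simp only [mem_ofPred_eq, mem_insert_iff, mem_singleton_iff]
  constructor
  · rintro ⟨hx0, hx⟩
    rcases le_total x m with hxm | hxm
    · exact Or.inl (hanti.injOn ⟨hx0, hxm⟩ ⟨hlc.le, hlm.le⟩ (hx.trans hroot.symm))
    · exact Or.inr (hmono.injOn hxm hx₂.1.le (hx.trans hfx₂.symm))
  · rintro (rfl | rfl)
    · exact ⟨hlc.le, hroot⟩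
    · exact ⟨(hm0.trans hx₂.1).le, hfx₂⟩

end RenewalRisk

namespace RenewalRisk

/-! ### The gamma-time model -/

variable {Ω : Type*} [MeasurableSpace Ω] {P : Measure Ω}
  {T X : ℕ → Ω → ℝ} {r lam α c : ℝ}

theorem integral_of_hasLaw_gammaMeasure {Z : Ω → ℝ} {a b : ℝ} (ha : 0 < a) (hb : 0 < b)
    (hZ : HasLaw Z (gammaMeasure a b) P) : ∫ ω, Z ω ∂P = a / b := by
  rw [hZ.integral_eq, integral_id_gammaMeasure ha hb]

theorem tendsto_sum_div_of_hasLaw_gammaMeasure [IsProbabilityMeasure P] {Z : ℕ → Ω → ℝ} {a b : ℝ} (ha : 0 < a)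
    (hb : 0 < b) (hZ : ∀ i, HasLaw (Z i) (gammaMeasure a b) P) (hind : iIndepFun Z P) :
    ∀ᵐ ω ∂P, Tendsto (fun n : ℕ => (∑ i ∈ Finset.range n, Z i ω) / n) atTop (𝓝 (a / b)) := by
  rw [← integral_of_hasLaw_gammaMeasure ha hb (hZ 0)]
  refine strong_law_ae_real Z ?_ (fun i j hij => hind.indepFun hij)
    fun i => ⟨(hZ i).aemeasurable, (hZ 0).aemeasurable, (hZ i).map_eq.trans (hZ 0).map_eq.symm⟩
  -- A non-integrable function has integral 0 by convention, whereas this mean is positive.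
  refine .of_integral_ne_zero ?_
  rw [integral_of_hasLaw_gammaMeasure ha hb (hZ 0)]
  positivity

theorem tendsto_atTop_of_tendsto_div {s : ℕ → ℝ} {l : ℝ} (hl : 0 < l)
    (h : Tendsto (fun n : ℕ => s n / n) atTop (𝓝 l)) : Tendsto s atTop atTop := by
  refine (h.pos_mul_atTop hl tendsto_natCast_atTop_atTop).congr' ?_
  filter_upwards [eventually_ge_atTop 1] with n hn
  rw [div_mul_cancel₀]
  positivity

theorem IsGammaTimeModel.congr {T' X' : ℕ → Ω → ℝ} (h : IsGammaTimeModel P T X r lam α)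
    (hT : ∀ i, T' i =ᵐ[P] T i) (hX : ∀ i, X' i =ᵐ[P] X i) :
    IsGammaTimeModel P T' X' r lam α where
  waiting_law i := (h.waiting_law i).congr (hT i)
  claim_law i := (h.claim_law i).congr (hX i)
  indep := h.indep.congr (by rintro (i | i); exacts [(hT i).symm, (hX i).symm])

theorem ruinProbability_congr {T' X' : ℕ → Ω → ℝ} (hT : ∀ i, T' i =ᵐ[P] T i)
    (hX : ∀ i, X' i =ᵐ[P] X i) (c u : ℝ) :
    ruinProbability P T' X' c u = ruinProbability P T X c u := by
  refine measureReal_congr ?_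
  filter_upwards [ae_all_iff.2 hT, ae_all_iff.2 hX] with ω hTω hXω
  have key : ∀ t, surplus T' X' c u t ω = surplus T X c u t ω := fun t => by
    simp only [surplus, claimNumber, arrivalTime, hTω, hXω]
  change ((⨅ t : {t : ℝ // 0 < t}, (surplus T' X' c u t ω : EReal)) < 0) =
    ((⨅ t : {t : ℝ // 0 < t}, (surplus T X c u t ω : EReal)) < 0)
  simp only [key]

theorem NetProfit.lt (hr : 0 < r) (hlam : 0 < lam) (hα : 0 < α) (hc : 0 < c)
    (hm : IsGammaTimeModel P T X r lam α) (h : NetProfit P T X c) : lam / c < r * α := by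
  have h0 := h 0
  rw [integral_of_hasLaw_gammaMeasure hr hlam (hm.waiting_law 0),
    integral_of_hasLaw_gammaMeasure one_pos hα (hm.claim_law 0), ← mul_div_assoc,
    div_lt_div_iff₀ hα hlam] at h0
  rw [div_lt_iff₀ hc]
  linarith

theorem IsGammaTimeModel.ae_waiting_pos (h : IsGammaTimeModel P T X r lam α) :
    ∀ᵐ ω ∂P, ∀ i, 0 < T i ω :=
  ae_all_iff.2 fun i => by
    have h1 := ae_gammaMeasure_pos r lam
    rw [← (h.waiting_law i).map_eq] at h1
    exact ae_of_ae_map (h.waiting_law i).aemeasurable h1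

theorem IsGammaTimeModel.ae_tendsto_waiting [IsProbabilityMeasure P] (hr : 0 < r) (hlam : 0 < lam)
    (h : IsGammaTimeModel P T X r lam α) :
    ∀ᵐ ω ∂P, Tendsto (fun n : ℕ => (∑ i ∈ Finset.range n, T i ω) / n) atTop (𝓝 (r / lam)) :=
  tendsto_sum_div_of_hasLaw_gammaMeasure hr hlam h.waiting_law
    (iIndepFun.precomp (f := Sum.elim T X) Sum.inl_injective h.indep)

theorem IsGammaTimeModel.ae_tendsto_claim [IsProbabilityMeasure P] (hα : 0 < α) (h : IsGammaTimeModel P T X r lam α) :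
    ∀ᵐ ω ∂P, Tendsto (fun n : ℕ => (∑ i ∈ Finset.range n, X i ω) / n) atTop (𝓝 (1 / α)) :=
  tendsto_sum_div_of_hasLaw_gammaMeasure one_pos hα h.claim_law
    (iIndepFun.precomp (f := Sum.elim T X) Sum.inr_injective h.indep)

theorem IsGammaTimeModel.ae_tendsto_walk [IsProbabilityMeasure P] (hr : 0 < r) (hlam : 0 < lam) (hα : 0 < α) (hc : 0 < c)
    (hnet : lam / c < r * α) (h : IsGammaTimeModel P T X r lam α) :
    ∀ᵐ ω ∂P, Tendsto (fun n => ∑ i ∈ Finset.range n, (c * T i ω - X i ω)) atTop atTop := by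
  filter_upwards [h.ae_tendsto_waiting hr hlam, h.ae_tendsto_claim hα] with ω hT hX
  refine tendsto_atTop_of_tendsto_div (l := c * (r / lam) - 1 / α) ?_
    (((hT.const_mul c).sub hX).congr fun n => ?_)
  · rw [div_lt_iff₀ hc] at hnet
    rw [sub_pos, ← mul_div_assoc, div_lt_div_iff₀ hα hlam]
    linarith
  · rw [Finset.sum_sub_distrib, ← Finset.mul_sum]
    ring

theorem IsGammaTimeModel.indepFun_stoppedWalk (h : IsGammaTimeModel P T X r lam α)
    (hT : ∀ i, Measurable (T i)) (hX : ∀ i, Measurable (X i)) (c u : ℝ) (n : ℕ) :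
    IndepFun (fun ω => stoppedWalk (fun i => c * T i ω - X i ω) u n) (fun ω => (T n ω, X n ω)) P := by
  -- `idx` forgets whether a variable is a waiting time or a claim, so past and present are
  -- separated by idx < n and idx = n.
  let idx : ℕ ⊕ ℕ → ℕ := Sum.elim id id
  have hZ : ∀ k, Measurable (Sum.elim T X k) := by rintro (i | i); exacts [hT i, hX i]
  have hind := indep_iSup_of_disjoint (S := {k | idx k < n}) (T := {k | idx k = n})
    (fun k => (hZ k).comap_le) h.indep.iIndep
    (Set.disjoint_left.2 fun k (hk : idx k < n) (hk' : idx k = n) => by omega)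
  have hmeas : ∀ (S : Set (ℕ ⊕ ℕ)) (k : ℕ ⊕ ℕ), k ∈ S → Measurable[⨆ j ∈ S,
      MeasurableSpace.comap (Sum.elim T X j) inferInstance] (Sum.elim T X k) := fun S k hk =>
    (comap_measurable _).mono (le_iSup₂_of_le k hk le_rfl) le_rfl
  refine indep_of_indep_of_le_left (indep_of_indep_of_le_right hind ?_) ?_
  · exact Measurable.comap_le (Measurable.prodMk (hmeas _ (Sum.inl n) rfl) (hmeas _ (Sum.inr n) rfl))
  · exact Measurable.comap_le (measurable_stoppedWalk u n fun i hi =>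
      ((hmeas _ (Sum.inl i) hi).const_mul c).sub (hmeas _ (Sum.inr i) hi))

theorem IsGammaTimeModel.map_prodMk [IsProbabilityMeasure P] (h : IsGammaTimeModel P T X r lam α) (n : ℕ) :
    P.map (fun ω => (T n ω, X n ω)) = (gammaMeasure r lam).prod (expMeasure α) := by
  have hind : IndepFun (T n) (X n) P :=
    h.indep.indepFun (i := Sum.inl n) (j := Sum.inr n) Sum.inl_ne_inr
  rw [(indepFun_iff_map_prod_eq_prod_map_map (h.waiting_law n).aemeasurable
    (h.claim_law n).aemeasurable).1 hind, (h.waiting_law n).map_eq, (h.claim_law n).map_eq]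

theorem IsGammaTimeModel.integral_ruinProfile_stoppedWalk [IsProbabilityMeasure P] {C γ : ℝ} (hr : 0 < r) (hlam : 0 < lam)
    (hc : 0 < c) (hγ : 0 < γ) (hγα : γ < α) (hC : C = (α - γ) / α)
    (hC' : C = (lam / (lam + c * γ)) ^ r) (h : IsGammaTimeModel P T X r lam α)
    (hT : ∀ i, Measurable (T i)) (hX : ∀ i, Measurable (X i)) (u : ℝ) (n : ℕ) :
    ∫ ω, ruinProfile C γ (stoppedWalk (fun i => c * T i ω - X i ω) u n) ∂P =
      ruinProfile C γ u := by
  have hα : 0 < α := hγ.trans hγα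
  have hC0 : 0 ≤ C := hC ▸ div_nonneg (by linarith) hα.le
  have hC1 : C ≤ 1 := by rw [hC, div_le_one hα]; linarith
  have := isProbabilityMeasure_gammaMeasure hr hlam
  have := isProbabilityMeasure_expMeasure hα
  induction n with
  | zero => simp [stoppedWalk]
  | succ n ih =>
    set V : Ω → ℝ := fun ω => stoppedWalk (fun i => c * T i ω - X i ω) u n with hV
    have hVm : Measurable V :=
      measurable_stoppedWalk u n fun i _ => ((hT i).const_mul c).sub (hX i)
    have hTX : Measurable fun ω => (T n ω, X n ω) := (hT n).prodMk (hX n)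
    -- One transition of the stopped walk; independence allows integrating out the new pair with the
    -- current position fixed.
    let F : ℝ × ℝ × ℝ → ℝ := fun q => if q.1 < 0 then q.1 else q.1 + (c * q.2.1 - q.2.2)
    have hF : Measurable F :=
      Measurable.ite (measurable_fst measurableSet_Iio) measurable_fst (by fun_prop)
    have hmap : P.map (fun ω => (V ω, (T n ω, X n ω))) =
        (P.map V).prod ((gammaMeasure r lam).prod (expMeasure α)) := by
      rw [(indepFun_iff_map_prod_eq_prod_map_map hVm.aemeasurable hTX.aemeasurable).1
        (h.indepFun_stoppedWalk hT hX c u n), h.map_prodMk]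
    have := Measure.isProbabilityMeasure_map (μ := P) hVm.aemeasurable
    have hgm := measurable_ruinProfile C γ
    calc ∫ ω, ruinProfile C γ (stoppedWalk (fun i => c * T i ω - X i ω) u (n + 1)) ∂P
        = ∫ ω, ruinProfile C γ (F (V ω, (T n ω, X n ω))) ∂P := rfl
      _ = ∫ q, ruinProfile C γ (F q) ∂(P.map fun ω => (V ω, (T n ω, X n ω))) :=
        (integral_map (hVm.prodMk hTX).aemeasurable
          (hgm.comp hF).aestronglyMeasurable).symm
      _ = ∫ v, ∫ p, ruinProfile C γ (F (v, p)) ∂(gammaMeasure r lam).prod (expMeasure α)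
            ∂(P.map V) := by
        rw [hmap, integral_prod _ (integrable_ruinProfile_comp hC0 hC1 hγ.le hF)]
      _ = ∫ v, ruinProfile C γ v ∂(P.map V) := by
        refine integral_congr_ae (ae_of_all _ fun v => ?_)
        rcases lt_or_ge v 0 with hv | hv
        · simp [F, hv]
        · simp only [F, not_lt.2 hv, if_false]
          exact integral_ruinProfile_step hr hlam hc hγ hγα hC hC' hv
      _ = ∫ ω, ruinProfile C γ (V ω) ∂P :=
        integral_map hVm.aemeasurable hgm.aestronglyMeasurable
      _ = ruinProfile C γ u := ih

theorem IsGammaTimeModel.ruinProbability_eq_of_measurable [IsProbabilityMeasure P] {C γ u : ℝ} (hr : 0 < r)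
    (hlam : 0 < lam) (hc : 0 < c) (hγ : 0 < γ) (hγα : γ < α) (hC : C = (α - γ) / α)
    (hC' : C = (lam / (lam + c * γ)) ^ r) (hnet : lam / c < r * α)
    (h : IsGammaTimeModel P T X r lam α)
    (hT : ∀ i, Measurable (T i)) (hX : ∀ i, Measurable (X i)) (hu : 0 < u) :
    ruinProbability P T X c u = C * Real.exp (-(γ * u)) := by
  classical
  have hα : 0 < α := hγ.trans hγα
  have hC0 : 0 ≤ C := hC ▸ div_nonneg (by linarith) hα.le
  have hC1 : C ≤ 1 := by rw [hC, div_le_one hα]; linarith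
  set E : Set Ω := {ω | ∃ n, u + ∑ i ∈ Finset.range n, (c * T i ω - X i ω) < 0} with hE
  have hEm : MeasurableSet E := by
    have hs : E = ⋃ n, {ω | u + ∑ i ∈ Finset.range n, (c * T i ω - X i ω) < 0} := by
      ext ω; simp [hE]
    rw [hs]
    exact MeasurableSet.iUnion fun n => measurableSet_lt (by fun_prop) measurable_const
  have hruin : ruinProbability P T X c u = P.real E := by
    refine measureReal_congr ?_
    filter_upwards [h.ae_waiting_pos, h.ae_tendsto_waiting hr hlam] with ω hpos hlim
    exact propext (iInf_surplus_neg_iff hc hu hpos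
      (tendsto_atTop_of_tendsto_div (div_pos hr hlam) hlim))
  have hlim : Tendsto (fun n => ∫ ω, ruinProfile C γ
      (stoppedWalk (fun i => c * T i ω - X i ω) u n) ∂P) atTop
      (𝓝 (∫ ω, E.indicator 1 ω ∂P)) := by
    refine tendsto_integral_of_dominated_convergence (fun _ => 1) (fun n => ?_)
      (integrable_const 1) (fun n => ae_of_all _ fun ω => norm_ruinProfile_le hC0 hC1 hγ.le _) ?_
    · exact ((measurable_ruinProfile C γ).comp (measurable_stoppedWalk u n fun i _ =>
        ((hT i).const_mul c).sub (hX i))).aestronglyMeasurable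
    · filter_upwards [h.ae_tendsto_walk hr hlam hα hc hnet] with ω hω
      convert tendsto_ruinProfile_stoppedWalk (u := u) (C := C) hγ hω using 2
      simp [indicator, hE]
  simp only [h.integral_ruinProfile_stoppedWalk hr hlam hc hγ hγα hC hC' hT hX] at hlim
  rw [hruin, ← integral_indicator_one hEm, ← tendsto_nhds_unique tendsto_const_nhds hlim,
    ruinProfile_of_nonneg C γ hu.le]

/-- The laws give only a.e. measurability, so the variables are replaced by measurable versions. -/
theorem IsGammaTimeModel.ruinProbability_eq [IsProbabilityMeasure P] {C γ u : ℝ} (hr : 0 < r)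
    (hlam : 0 < lam) (hc : 0 < c) (hγ : 0 < γ) (hγα : γ < α) (hC : C = (α - γ) / α)
    (hC' : C = (lam / (lam + c * γ)) ^ r) (hnet : lam / c < r * α)
    (h : IsGammaTimeModel P T X r lam α) (hu : 0 < u) :
    ruinProbability P T X c u = C * Real.exp (-(γ * u)) := by
  have hT : ∀ i, (h.waiting_law i).aemeasurable.mk =ᵐ[P] T i :=
    fun i => (h.waiting_law i).aemeasurable.ae_eq_mk.symm
  have hX : ∀ i, (h.claim_law i).aemeasurable.mk =ᵐ[P] X i :=
    fun i => (h.claim_law i).aemeasurable.ae_eq_mk.symm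
  rw [← ruinProbability_congr hT hX]
  exact (h.congr hT hX).ruinProbability_eq_of_measurable hr hlam hc hγ hγα hC hC' hnet
    (fun i => (h.waiting_law i).aemeasurable.measurable_mk)
    (fun i => (h.claim_law i).aemeasurable.measurable_mk) hu

end RenewalRisk

theorem mainTheorem6 {Ω : Type*} [MeasurableSpace Ω] (P : Measure Ω) [IsProbabilityMeasure P]
    (T X : ℕ → Ω → ℝ) (r lam α c : ℝ)
    (hr : 0 < r) (hlam : 0 < lam) (hα : 0 < α) (hc : 0 < c)
    (hmodel : RenewalRisk.IsGammaTimeModel P T X r lam α)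
    (hprofit : RenewalRisk.NetProfit P T X c) :
    ∃ x₂ : ℝ, lam / c < x₂ ∧
      {x : ℝ | 0 ≤ x ∧ c ^ r * x ^ r * (x - (lam / c + α)) + α * lam ^ r = 0} = {lam / c, x₂} ∧
      ∀ u : ℝ, 0 < u →
        RenewalRisk.ruinProbability P T X c u =
          (lam / (c * x₂)) ^ r * Real.exp (-(x₂ - lam / c) * u) := by
  have hnet := RenewalRisk.NetProfit.lt hr hlam hα hc hmodel hprofit
  obtain ⟨x₂, hlt, hlt', hroots⟩ := RenewalRisk.exists_larger_root hr hlam hα hc hnet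
  refine ⟨x₂, hlt, hroots, fun u hu => ?_⟩
  have hx₂ : 0 < x₂ := (div_pos hlam hc).trans hlt
  have hmem : x₂ ∈ ({lam / c, x₂} : Set ℝ) := Or.inr rfl
  rw [← hroots] at hmem
  have hden : lam + c * (x₂ - lam / c) = c * x₂ := by field_simp; ring
  -- The characteristic equation at x₂, divided by α c^r x₂^r.
  have hC : (lam / (c * x₂)) ^ r = (α - (x₂ - lam / c)) / α := by
    have hpow : 0 < c ^ r * x₂ ^ r :=
      mul_pos (Real.rpow_pos_of_pos hc r) (Real.rpow_pos_of_pos hx₂ r)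
    rw [Real.div_rpow hlam.le (by positivity), Real.mul_rpow hc.le hx₂.le,
      div_eq_div_iff hpow.ne' hα.ne']
    linarith [hmem.2]
  rw [hmodel.ruinProbability_eq hr hlam hc (sub_pos.2 hlt) (by linarith) hC (by rw [hden]) hnet hu,
    neg_mul]
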